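/- Let $\Omega\subset\mathbb R^d$ be a bounded open set, $H:=L^2(\Omega)$ (real or complex), and let $A$ be a (possibly unbounded) self-adjoint operator in $H$ that is positive, $\langle A\varphi,\varphi\rangle>0$ for all $0\ne\varphi\in D(A)$, and has discrete spectrum (every point of $\sigma(A)$ is isolated in $\sigma(A)$ and is an eigenvalue of finite multiplicity). Let $E_\lambda$ be the resolution of the identity of $A$, let $\mathcal H^1:=\{\varphi\in H : \|\varphi\|_1^2:=\int(1+\lambda^2)\,d\langle E_\lambda\varphi,\varphi\rangle<\infty\}$, and define functions of $A$ by the spectral calculus. Let $T>0$ and assume that none of the numbers $k\pi/T$, $k=1,2,\dots$, is an eigenvalue of $A$. Let $$V_h:=\{v\in C([0,T];\mathcal H^1) : \partial_t v\in C([0,T];H),\ (\partial_t^2+A^2)v=0\},$$ where the equation is understood weakly: $\frac{d}{dt}\langle \psi,\partial_t v(t)\rangle=-\langle A\psi,Av(t)\rangle$ on $(0,T)$ for all $\psi\in\mathcal H^1$. Let $f,g\in\mathcal H^1$ and suppose that the Dirichlet problem $$(P_h)\qquad (\partial_t^2+A^2)u=0\ \text{ in }(0,T),\qquad u(0)=f,\qquad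 u(T)=g$$ is consistent, i.e. has a solution $u\in V_h$. Define the affine operator $T_h:H\to H$ by $$T_h(\varphi):=\cos(AT)^2\varphi+h_{f,g},\qquad h_{f,g}:=-\cos(AT)\sin(AT)\,Af+\sin(AT)\,Ag .$$ Then for every $\varphi_0\in H$ the iterates $\varphi_k:=T_h^k(\varphi_0)$ converge to $\partial_t u(0)$ in the norm of $H$. Moreover, let $(\varphi_k)_{k\ge0}$ be any sequence in $H$ produced by the following procedure: for each $k$ there are $v,w\in V_h$ with $v(0)=f$, $\partial_t v(0)=\varphi_k$, $w(T)=g$, $\partial_t w(T)=\partial_t v(T)$ and $\varphi_{k+1}=\partial_t w(0)$. Then $\varphi_k=T_h^k(\varphi_0)$ for all $k$, and hence $\varphi_k\to\partial_t u(0)$ in $H$. -/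

import Mathlib

open Filter Topology Set MeasureTheory
open scoped ENNReal

noncomputable section

namespace HyperbolicDirichlet

/-! ### Unbounded operators on a Hilbert space: eigenspaces, spectrum, spectral calculus -/

section Operators

variable {𝕜 : Type*} [RCLike 𝕜] {H : Type*} [NormedAddCommGroup H] [InnerProductSpace 𝕜 H]

/-- The eigenspace `ker (A - z)`, a subspace of `H` (contained in the domain of `A`). -/
def eigenspace (A : H →ₗ.[𝕜] H) (z : 𝕜) : Submodule 𝕜 H :=
  (LinearMap.ker (A.toFun - z • A.domain.subtype)).map A.domain.subtype

/-- The spectrum of a closed operator `A` with domain `D(A)`: all `z` for which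
`A - z : D(A) → H` is not a bijection. (For closed `A`, hence for self-adjoint `A`, the inverse of
such a bijection is bounded by the closed graph theorem.) -/
def spectrum (A : H →ₗ.[𝕜] H) : Set 𝕜 :=
  {z | ¬ Function.Bijective fun x : A.domain => A x - z • (x : H)}

/-- `A` has discrete spectrum: every point of the spectrum is an isolated point of the spectrum
and an eigenvalue of finite multiplicity. -/
def HasDiscreteSpectrum (A : H →ₗ.[𝕜] H) : Prop :=
  ∀ z ∈ spectrum A,
    (∀ᶠ w in 𝓝[≠] z, w ∉ spectrum A) ∧ eigenspace A z ≠ ⊥ ∧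
      FiniteDimensional 𝕜 (eigenspace A z)

/-- `A` is positive: `⟨A x, x⟩ > 0` for all nonzero `x` in the domain. -/
def IsPositive (A : H →ₗ.[𝕜] H) : Prop :=
  ∀ x : A.domain, (x : H) ≠ 0 → 0 < RCLike.re (inner 𝕜 (A x) (x : H))

variable [CompleteSpace H]

/-- The atom `E({l})` at `l` of the resolution of the identity of a self-adjoint operator `A`: the
orthogonal projection onto `ker (A - l)`. The eigenspaces of a self-adjoint operator are closed, so
the closure does not change them. -/
def spectralProj (A : H →ₗ.[𝕜] H) (l : ℝ) : H →L[𝕜] H :=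
  (eigenspace A (l : 𝕜)).topologicalClosure.starProjection

/-- The spectral calculus `F(A) φ = ∫ F(l) dE_l φ`. For a self-adjoint operator with discrete
spectrum the resolution of the identity is purely atomic, so the integral is the (unconditional)
sum of `F(l) E({l}) φ` over the eigenvalues `l`; at all other `l` the projection vanishes. -/
def spectralMap (A : H →ₗ.[𝕜] H) (F : ℝ → ℝ) (φ : H) : H :=
  ∑' l : ℝ, ((F l : ℝ) : 𝕜) • spectralProj A l φ

/-- The norm `‖φ‖_s = (∫ (1 + l²)^s d⟨E_l φ, φ⟩)^{1/2}`, with value `∞` allowed. -/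
def sobolevNorm (A : H →ₗ.[𝕜] H) (s : ℝ) (φ : H) : ℝ≥0∞ :=
  (∑' l : ℝ, ENNReal.ofReal ((1 + l ^ 2) ^ s * ‖spectralProj A l φ‖ ^ 2)) ^ (1 / 2 : ℝ)

/-- The space `𝓗^s`, `s ≥ 0`, of all `φ` with `‖φ‖_s < ∞`. -/
def sobolev (A : H →ₗ.[𝕜] H) (s : ℝ) : Set H :=
  {φ | sobolevNorm A s φ < ∞}

/-- The operator `A` on `𝓗^1`. -/
def opA (A : H →ₗ.[𝕜] H) (φ : H) : H := spectralMap A (fun l => l) φ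

/-- The bounded operator `cos (A T)`. -/
def cosA (A : H →ₗ.[𝕜] H) (T : ℝ) (φ : H) : H := spectralMap A (fun l => Real.cos (l * T)) φ

/-- The bounded operator `sin (A T)`. -/
def sinA (A : H →ₗ.[𝕜] H) (T : ℝ) (φ : H) : H := spectralMap A (fun l => Real.sin (l * T)) φ

/-- The affine operator `φ ↦ cos(AT)² φ + h` on `H`, with
`h = - cos(AT) sin(AT) A f + sin(AT) A g`. -/
def iterMap (A : H →ₗ.[𝕜] H) (T : ℝ) (f g φ : H) : H :=
  cosA A T (cosA A T φ) + (-cosA A T (sinA A T (opA A f)) + sinA A T (opA A g))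

end Operators

/-! ### The wave equation `(∂_t² + A²) u = 0` -/

section Wave

variable {𝕜 : Type*} [RCLike 𝕜] {H : Type*} [NormedAddCommGroup H] [InnerProductSpace 𝕜 H]
  [NormedSpace ℝ H]

/-- The time derivative `∂_t u` on `[0, T]` (one-sided at the end points), in the norm of `H`. -/
def timeDeriv (T : ℝ) (u : ℝ → H) (t : ℝ) : H := derivWithin u (Icc 0 T) t

variable [CompleteSpace H]

/-- `u ∈ V_h`: `u ∈ C([0,T]; 𝓗^1)`, `∂_t u ∈ C([0,T]; H)` and `(∂_t² + A²) u = 0`. The equation is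
read in the dual of `𝓗^1`: for every `ψ ∈ 𝓗^1` one has
`d/dt ⟨ψ, ∂_t u(t)⟩ = - ⟨A ψ, A u(t)⟩` on `(0,T)`. Since `∂_t u` and `A u` are continuous in `H`,
this is the same as the equation in the sense of distributions in time.
Only the values of `u` on `[0,T]` matter. -/
structure MemVh (A : H →ₗ.[𝕜] H) (T : ℝ) (u : ℝ → H) : Prop where
  mem : ∀ t ∈ Icc 0 T, u t ∈ sobolev A 1
  cont : ∀ t ∈ Icc 0 T, Tendsto (fun s => sobolevNorm A 1 (u s - u t)) (𝓝[Icc 0 T] t) (𝓝 0)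
  diff : DifferentiableOn ℝ u (Icc 0 T)
  cont_deriv : ContinuousOn (timeDeriv T u) (Icc 0 T)
  wave : ∀ ψ ∈ sobolev A 1, ∀ t ∈ Ioo 0 T,
    HasDerivAt (fun s => inner 𝕜 ψ (timeDeriv T u s)) (-inner 𝕜 (opA A ψ) (opA A (u t))) t

/-- `u` is a solution in `V_h` of the Dirichlet problem `(P_h)` with data `u(0) = f`, `u(T) = g`. -/
structure SolvesDirichlet (A : H →ₗ.[𝕜] H) (T : ℝ) (f g : H) (u : ℝ → H) : Prop where
  memVh : MemVh A T u
  initial : u 0 = f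
  final : u T = g

/-- One step `φ ↦ φ'` of the iterative procedure: solve the wave equation for `v` with
`v(0) = f`, `∂_t v(0) = φ`, then for `w` with `w(T) = g`, `∂_t w(T) = ∂_t v(T)`, and put
`φ' = ∂_t w(0)`. -/
def IsIterStep (A : H →ₗ.[𝕜] H) (T : ℝ) (f g φ φ' : H) : Prop :=
  ∃ v w : ℝ → H, MemVh A T v ∧ MemVh A T w ∧
    v 0 = f ∧ timeDeriv T v 0 = φ ∧
    w T = g ∧ timeDeriv T w T = timeDeriv T v T ∧
    timeDeriv T w 0 = φ'

end Wave

end HyperbolicDirichlet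

end

/-! On `ker (A - l)` a wave is a scalar oscillator, and the Cauchy data rotate: `(l * v, v')` turns
by the angle `l * T` (`oscillator_endpoints`). Write `c`, `s` for the cosine and sine of `l * T`.
Solving forwards and then backwards gives `φ' = c²φ - l c s f + l s g`, which is `iterMap`.
Consistency says `l g = l c f + s u'(0)`, so this becomes `φ' = c²φ + s²u'(0)`, and the error is
multiplied by `c²` at each step. Positivity and nonresonance give `c² < 1` on every nonzero
eigenspace, but not uniformly in `l`. Convergence therefore comes from Parseval and dominated
convergence (`tendsto_of_inner_eq_pow`), without a rate.

Parseval requires the eigenvectors to be total (`eq_zero_of_forall_inner_eigenspace`), which is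
proved without the spectral theorem. The inverse `R` of `A` is bounded and positive, and leaves
invariant the orthogonal complement `N` of all eigenvectors. If `N` were nonzero, the top of the
numerical range of `R` on `N` would be positive, isolated in the spectrum and not an eigenvalue. The
gap lemmas for bounded symmetric operators then push that top strictly down, a contradiction. -/

namespace HyperbolicDirichlet

/-! ### Spectral gaps of bounded symmetric operators. -/

section BoundedOperators

variable {𝕜 : Type*} [RCLike 𝕜] {H : Type*} [NormedAddCommGroup H] [InnerProductSpace 𝕜 H]

/-- Cauchy-Schwarz inequality for the form of a positive semidefinite operator. -/
theorem sq_re_inner_le_of_nonneg {Q : H →L[𝕜] H} (hs : (Q : H →ₗ[𝕜] H).IsSymmetric)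
    (hp : ∀ x, 0 ≤ RCLike.re (inner 𝕜 (Q x) x)) (x y : H) :
    RCLike.re (inner 𝕜 (Q x) y) ^ 2 ≤
      RCLike.re (inner 𝕜 (Q x) x) * RCLike.re (inner 𝕜 (Q y) y) := by
  -- The form at `x + t y` is a nonnegative quadratic in `t`. Real `t` suffice because only the real
  -- part is estimated.
  have key : ∀ t : ℝ, 0 ≤ RCLike.re (inner 𝕜 (Q y) y) * (t * t) +
      (2 * RCLike.re (inner 𝕜 (Q x) y)) * t + RCLike.re (inner 𝕜 (Q x) x) := by
    intro t
    have h := hp (x + (t : 𝕜) • y)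
    have h1 : RCLike.re (inner 𝕜 (Q y) x) = RCLike.re (inner 𝕜 (Q x) y) := by
      have := hs y x
      simp only [ContinuousLinearMap.coe_coe] at this
      rw [this, ← inner_conj_symm, RCLike.conj_re]
    simp only [map_add, map_smul, inner_add_left, inner_add_right, inner_smul_left,
      inner_smul_right, RCLike.conj_ofReal, RCLike.re_ofReal_mul, h1] at h
    linarith
  have := discrim_le_zero key
  unfold discrim at this
  linarith

/-- Cauchy-Schwarz for the form with `y = Q x`, after cancelling `‖Q x‖ ^ 2`. It turns a lower bound
on `‖Q x‖` into one on the form of `Q`. -/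
theorem norm_sq_apply_le_of_nonneg {Q : H →L[𝕜] H} (hs : (Q : H →ₗ[𝕜] H).IsSymmetric)
    (hp : ∀ x, 0 ≤ RCLike.re (inner 𝕜 (Q x) x)) (x : H) :
    ‖Q x‖ ^ 2 ≤ ‖Q‖ * RCLike.re (inner 𝕜 (Q x) x) := by
  rcases eq_or_ne (Q x) 0 with h0 | h0
  · simp [h0]
  have h := sq_re_inner_le_of_nonneg hs hp x (Q x)
  rw [inner_self_eq_norm_sq] at h
  have h2 : RCLike.re (inner 𝕜 (Q (Q x)) (Q x)) ≤ ‖Q‖ * ‖Q x‖ ^ 2 := by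
    refine (re_inner_le_norm _ _).trans ?_
    nlinarith [Q.le_opNorm (Q x), norm_nonneg (Q x)]
  have h3 : 0 < ‖Q x‖ ^ 2 := by positivity
  refine le_of_mul_le_mul_right ?_ h3
  nlinarith [mul_le_mul_of_nonneg_left h2 (hp x)]

theorem norm_sub_smul_sq (x y : H) (c : ℝ) :
    ‖y - (c : 𝕜) • x‖ ^ 2 = ‖y‖ ^ 2 - 2 * c * RCLike.re (inner 𝕜 y x) + c ^ 2 * ‖x‖ ^ 2 := by
  rw [@norm_sub_sq 𝕜, inner_smul_right, RCLike.re_ofReal_mul, norm_smul, RCLike.norm_ofReal,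
    mul_pow, sq_abs]
  ring

/-- If `B - s` is bounded below for all real `s` with `|s| < δ`, then `‖B x‖ ≥ δ ‖x‖`. -/
theorem le_norm_apply_of_gap {B : H →L[𝕜] H} (hs : (B : H →ₗ[𝕜] H).IsSymmetric) {δ : ℝ}
    (hgap : ∀ s : ℝ, |s| < δ → ∃ κ > 0, ∀ x, κ * ‖x‖ ≤ ‖B x - (s : 𝕜) • x‖) (x₀ : H) :
    δ * ‖x₀‖ ≤ ‖B x₀‖ := by
  by_contra! hx₀
  have hx₀n : 0 < ‖x₀‖ := by
    rcases eq_or_ne x₀ 0 with h | h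
    · simp [h] at hx₀
    · positivity
  let S : Set ℝ := {m | ∀ x, m * ‖x‖ ≤ ‖B x‖}
  have hbdd : ∀ m ∈ S, m ≤ ‖B x₀‖ / ‖x₀‖ := fun m hm => by
    rw [le_div_iff₀ hx₀n]; exact hm x₀
  have h0S : (0 : ℝ) ∈ S := fun x => by simp
  -- The best lower bound of `B`. If it were below `δ`, both `B - m` and `B + m` would be bounded
  -- below.
  set m := sSup S with hm
  have hbS : BddAbove S := ⟨_, hbdd⟩
  have hm0 : 0 ≤ m := le_csSup hbS h0S
  have hmδ : m < δ := (csSup_le ⟨0, h0S⟩ hbdd).trans_lt (by rwa [div_lt_iff₀ hx₀n])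
  have hmS : m ∈ S := fun x => by
    rcases eq_or_ne x 0 with h | h
    · simp [h]
    · have hx : 0 < ‖x‖ := by positivity
      rw [← le_div_iff₀ hx]
      exact csSup_le ⟨0, h0S⟩ fun a ha => by rw [le_div_iff₀ hx]; exact ha x
  obtain ⟨κ₁, hκ₁, h₁⟩ := hgap m (by rwa [abs_of_nonneg hm0])
  obtain ⟨κ₂, hκ₂, h₂⟩ := hgap (-m) (by rwa [abs_neg, abs_of_nonneg hm0])
  -- `Q = (B - m)(B + m)` is bounded below as a product and has a nonnegative form by the choice of
  -- `m`. Hence its form is bounded below by some `η > 0`, and `m` was not optimal.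
  let Q : H →L[𝕜] H := B.comp B - ((m ^ 2 : ℝ) : 𝕜) • ContinuousLinearMap.id 𝕜 H
  have hBs : ∀ x y, inner 𝕜 (B x) y = inner 𝕜 x (B y) := hs
  have hQs : (Q : H →ₗ[𝕜] H).IsSymmetric := by
    intro x y
    simp [Q, inner_sub_left, inner_sub_right, inner_smul_left, inner_smul_right, hBs]
  have hQf : ∀ x, RCLike.re (inner 𝕜 (Q x) x) = ‖B x‖ ^ 2 - m ^ 2 * ‖x‖ ^ 2 := by
    intro x
    have : inner 𝕜 (Q x) x = inner 𝕜 (B x) (B x) - ((m ^ 2 : ℝ) : 𝕜) * inner 𝕜 x x := by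
      simp [Q, inner_sub_left, inner_smul_left, hBs]
    rw [this, map_sub, RCLike.re_ofReal_mul, inner_self_eq_norm_sq, inner_self_eq_norm_sq]
  have hQp : ∀ x, 0 ≤ RCLike.re (inner 𝕜 (Q x) x) := by
    intro x
    rw [hQf, sub_nonneg, ← mul_pow]
    exact pow_le_pow_left₀ (by positivity) (hmS x) 2
  have hQb : ∀ x, κ₁ * κ₂ * ‖x‖ ≤ ‖Q x‖ := by
    intro x
    have e : Q x = B (B x - ((-m : ℝ) : 𝕜) • x) - (m : 𝕜) • (B x - ((-m : ℝ) : 𝕜) • x) := by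
      simp only [Q, map_sub, map_smul, sub_apply, ContinuousLinearMap.comp_apply,
        smul_apply, ContinuousLinearMap.id_apply]
      push_cast
      module
    rw [e]
    refine le_trans ?_ (h₁ _)
    rw [mul_assoc]
    exact mul_le_mul_of_nonneg_left (h₂ x) hκ₁.le
  set η := (κ₁ * κ₂) ^ 2 / (‖Q‖ + 1) with hη
  have hη0 : 0 < η := by positivity
  have hBb : ∀ x, (m ^ 2 + η) * ‖x‖ ^ 2 ≤ ‖B x‖ ^ 2 := by
    intro x
    have a1 := norm_sq_apply_le_of_nonneg hQs hQp x
    have a2 : (κ₁ * κ₂ * ‖x‖) ^ 2 ≤ ‖Q x‖ ^ 2 := pow_le_pow_left₀ (by positivity) (hQb x) 2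
    have a3 : η * ‖x‖ ^ 2 ≤ RCLike.re (inner 𝕜 (Q x) x) := by
      rw [hη, div_mul_eq_mul_div, div_le_iff₀ (by positivity)]
      nlinarith [hQp x]
    rw [hQf] at a3
    linarith
  have hlt : m < √(m ^ 2 + η) := Real.lt_sqrt_of_sq_lt (by linarith)
  have : √(m ^ 2 + η) ∈ S := fun x => by
    refine (sq_le_sq₀ (by positivity) (norm_nonneg _)).mp ?_
    rw [mul_pow, Real.sq_sqrt (by positivity)]
    exact hBb x
  exact absurd (le_csSup hbS this) (not_le.mpr hlt)

/-- An injective positive semidefinite operator whose spectrum does not meet `(0, ε)` is bounded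
below by `ε`. -/
theorem le_re_inner_of_gap [CompleteSpace H] {P : H →L[𝕜] H}
    (hs : (P : H →ₗ[𝕜] H).IsSymmetric)
    (hp : ∀ x, 0 ≤ RCLike.re (inner 𝕜 (P x) x)) (hinj : ∀ x, P x = 0 → x = 0) {ε : ℝ}
    (hε : 0 < ε)
    (hgap : ∀ s : ℝ, 0 < s → s < ε → ∃ κ > 0, ∀ x, κ * ‖x‖ ≤ ‖P x - (s : 𝕜) • x‖) (x : H) :
    ε * ‖x‖ ^ 2 ≤ RCLike.re (inner 𝕜 (P x) x) := by
  have hPs : ∀ x y, inner 𝕜 (P x) y = inner 𝕜 x (P y) := hs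
  have h1 : ∀ x, ε * RCLike.re (inner 𝕜 (P x) x) ≤ ‖P x‖ ^ 2 := by
    intro x
    -- The shift centres the gap `(0, ε)` at the origin. Squaring `‖B x‖ ≥ (ε / 2) ‖x‖` cancels the
    -- terms in `‖x‖ ^ 2`.
    let B : H →L[𝕜] H := P - ((ε / 2 : ℝ) : 𝕜) • ContinuousLinearMap.id 𝕜 H
    have hB : ∀ x, B x = P x - ((ε / 2 : ℝ) : 𝕜) • x := fun x => rfl
    have hBs : (B : H →ₗ[𝕜] H).IsSymmetric := by
      intro x y
      simp only [ContinuousLinearMap.coe_coe, hB, inner_sub_left, inner_sub_right,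
        inner_smul_left, inner_smul_right, RCLike.conj_ofReal, hPs]
    have := le_norm_apply_of_gap hBs (δ := ε / 2) (fun s hs => by
      obtain ⟨h₁, h₂⟩ := abs_lt.mp hs
      obtain ⟨κ, hκ, h⟩ := hgap (ε / 2 + s) (by linarith) (by linarith)
      refine ⟨κ, hκ, fun x => ?_⟩
      have e : B x - (s : 𝕜) • x = P x - ((ε / 2 + s : ℝ) : 𝕜) • x := by
        rw [hB, RCLike.ofReal_add]; module
      rw [e]
      exact h x) x
    have h2 : (ε / 2 * ‖x‖) ^ 2 ≤ ‖B x‖ ^ 2 := pow_le_pow_left₀ (by positivity) this 2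
    rw [hB, norm_sub_smul_sq] at h2
    linarith
  -- The claim on the range of `P`. That range is dense, since `P` is symmetric and injective, and
  -- the inequality is a closed condition.
  have h2 : ∀ x, ε * ‖P x‖ ^ 2 ≤ RCLike.re (inner 𝕜 (P (P x)) (P x)) := by
    intro x
    rcases eq_or_ne (P x) 0 with h0 | h0
    · simp [h0]
    have h := sq_re_inner_le_of_nonneg hs hp x (P x)
    rw [inner_self_eq_norm_sq] at h
    have h3 : 0 < ‖P x‖ ^ 2 := by positivity
    refine le_of_mul_le_mul_right ?_ h3
    nlinarith [mul_le_mul_of_nonneg_right (h1 x) (hp (P x)), mul_le_mul_of_nonneg_left h hε.le]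
  have hd : DenseRange P := by
    have : (LinearMap.range (P : H →ₗ[𝕜] H)).topologicalClosure = ⊤ := by
      rw [Submodule.topologicalClosure_eq_top_iff, Submodule.eq_bot_iff]
      intro y hy
      refine hinj y ?_
      rw [Submodule.mem_orthogonal] at hy
      have := hy (P (P y)) ⟨P y, rfl⟩
      rw [hPs] at this
      exact inner_self_eq_zero.mp this
    have h := Submodule.dense_iff_topologicalClosure_eq_top.mpr this
    exact h
  have hc : IsClosed {z : H | ε * ‖z‖ ^ 2 ≤ RCLike.re (inner 𝕜 (P z) z)} := by
    refine isClosed_le (by fun_prop) ?_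
    exact RCLike.continuous_re.comp (P.continuous.inner continuous_id)
  exact hd.induction_on (p := fun z => ε * ‖z‖ ^ 2 ≤ RCLike.re (inner 𝕜 (P z) z)) x hc h2

/-- A positive bounded operator with isolated nonzero spectrum and without eigenvectors acts on the
zero space. -/
theorem eq_zero_of_isolated_of_no_eigenvector [CompleteSpace H] {R : H →L[𝕜] H}
    (hs : (R : H →ₗ[𝕜] H).IsSymmetric)
    (hp : ∀ x, x ≠ 0 → 0 < RCLike.re (inner 𝕜 (R x) x))
    (hinj : ∀ μ : ℝ, 0 < μ → ∀ x, R x = (μ : 𝕜) • x → x = 0)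
    (hiso : ∀ μ : ℝ, 0 < μ → ∃ ε > 0, ∀ s : ℝ, s ≠ μ → |s - μ| < ε →
      ∃ κ > 0, ∀ x, κ * ‖x‖ ≤ ‖R x - (s : 𝕜) • x‖) (x₀ : H) : x₀ = 0 := by
  by_contra hx₀
  have hRs : ∀ x y, inner 𝕜 (R x) y = inner 𝕜 x (R y) := hs
  let S : Set ℝ := {r | ∃ x : H, x ≠ 0 ∧ r = RCLike.re (inner 𝕜 (R x) x) / ‖x‖ ^ 2}
  have hne : S.Nonempty := ⟨_, x₀, hx₀, rfl⟩
  have hbS : BddAbove S := by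
    refine ⟨‖R‖, ?_⟩
    rintro r ⟨x, hx, rfl⟩
    rw [div_le_iff₀ (by positivity)]
    refine (re_inner_le_norm _ _).trans ?_
    nlinarith [R.le_opNorm x, norm_nonneg x]
  -- The top of the numerical range of `R`. The gap lemma applied to `μ - R` lowers it to `μ - ε`.
  set μ := sSup S with hμ
  have hμ0 : 0 < μ := by
    refine lt_of_lt_of_le ?_ (le_csSup hbS ⟨x₀, hx₀, rfl⟩)
    have := hp x₀ hx₀
    positivity
  have hle : ∀ x, RCLike.re (inner 𝕜 (R x) x) ≤ μ * ‖x‖ ^ 2 := by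
    intro x
    rcases eq_or_ne x 0 with h | h
    · simp [h]
    · rw [← div_le_iff₀ (by positivity)]
      exact le_csSup hbS ⟨x, h, rfl⟩
  obtain ⟨ε, hε, hgap⟩ := hiso μ hμ0
  let P : H →L[𝕜] H := (μ : 𝕜) • ContinuousLinearMap.id 𝕜 H - R
  have hP : ∀ x, P x = (μ : 𝕜) • x - R x := fun x => rfl
  have hPs : (P : H →ₗ[𝕜] H).IsSymmetric := by
    intro x y
    simp only [ContinuousLinearMap.coe_coe, hP, inner_sub_left, inner_sub_right,
      inner_smul_left, inner_smul_right, RCLike.conj_ofReal, hRs]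
  have hPf : ∀ x, RCLike.re (inner 𝕜 (P x) x) = μ * ‖x‖ ^ 2 - RCLike.re (inner 𝕜 (R x) x) := by
    intro x
    rw [hP, inner_sub_left, inner_smul_left, RCLike.conj_ofReal, map_sub, RCLike.re_ofReal_mul,
      inner_self_eq_norm_sq]
  have key := le_re_inner_of_gap hPs (fun x => by rw [hPf]; linarith [hle x])
    (fun x hx => hinj μ hμ0 x (by rw [hP, sub_eq_zero] at hx; exact hx.symm)) hε
    (fun s hs0 hsε => by
      obtain ⟨κ, hκ, h⟩ := hgap (μ - s) (by linarith) (by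
        rw [sub_sub_cancel_left, abs_neg, abs_of_pos hs0]; exact hsε)
      refine ⟨κ, hκ, fun x => ?_⟩
      have e : P x - (s : 𝕜) • x = -(R x - ((μ - s : ℝ) : 𝕜) • x) := by
        rw [hP, RCLike.ofReal_sub]; module
      rw [e, norm_neg]
      exact h x)
  have : μ ≤ μ - ε := by
    refine csSup_le hne ?_
    rintro r ⟨x, hx, rfl⟩
    rw [div_le_iff₀ (by positivity)]
    have := key x
    rw [hPf] at this
    linarith
  linarith

end BoundedOperators

/-! ### Totality of the eigenvectors. -/

section Resolution

variable {𝕜 : Type*} [RCLike 𝕜] {H : Type*} [NormedAddCommGroup H] [InnerProductSpace 𝕜 H]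

theorem mem_eigenspace {A : H →ₗ.[𝕜] H} {z : 𝕜} {x : H} :
    x ∈ eigenspace A z ↔ ∃ y : A.domain, A y = z • (y : H) ∧ (y : H) = x := by
  simp only [eigenspace, Submodule.mem_map, LinearMap.mem_ker, LinearMap.sub_apply,
    LinearMap.smul_apply, Submodule.subtype_apply, sub_eq_zero]
  rfl

theorem eigenspace_eq_bot_of_nonpos {A : H →ₗ.[𝕜] H} (hpos : IsPositive A) {l : ℝ} (hl : l ≤ 0) :
    eigenspace A (l : 𝕜) = ⊥ := by
  rw [Submodule.eq_bot_iff]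
  intro x hx
  obtain ⟨y, hy, rfl⟩ := mem_eigenspace.mp hx
  by_contra h0
  have h := hpos y h0
  rw [hy, inner_smul_left, RCLike.conj_ofReal, RCLike.re_ofReal_mul, inner_self_eq_norm_sq] at h
  nlinarith [sq_nonneg ‖(y : H)‖]

/-- The bounded inverse theorem, in the quantitative form in which the gap lemmas consume points
outside the spectrum. -/
theorem bounded_below_of_bijective [CompleteSpace H] (B : H →L[𝕜] H)
    (hB : Function.Bijective B) : ∃ κ > 0, ∀ x, κ * ‖x‖ ≤ ‖B x‖ := by
  let e := ContinuousLinearEquiv.ofBijective B (LinearMap.ker_eq_bot.mpr hB.1)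
    (LinearMap.range_eq_top.mpr hB.2)
  have he : ∀ x, e.symm (B x) = x := fun x => e.symm_apply_apply x
  refine ⟨(‖(e.symm : H →L[𝕜] H)‖ + 1)⁻¹, by positivity, fun x => ?_⟩
  rw [inv_mul_le_iff₀ (by positivity)]
  have := (e.symm : H →L[𝕜] H).le_opNorm (B x)
  rw [ContinuousLinearEquiv.coe_coe, he] at this
  nlinarith [norm_nonneg (B x)]

variable [CompleteSpace H]

theorem inner_apply_eq_of_isSelfAdjoint {A : H →ₗ.[𝕜] H} (hA : IsSelfAdjoint A)
    (x y : A.domain) : inner 𝕜 (A x) (y : H) = inner 𝕜 (x : H) (A y) := by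
  have h := LinearPMap.adjoint_isFormalAdjoint hA.dense_domain
  rw [LinearPMap.isSelfAdjoint_def.mp hA] at h
  exact h x y

theorem isOrtho_eigenspace {A : H →ₗ.[𝕜] H} (hA : IsSelfAdjoint A) {l m : ℝ} (hlm : l ≠ m) :
    eigenspace A (l : 𝕜) ⟂ eigenspace A (m : 𝕜) := by
  rw [Submodule.isOrtho_iff_inner_eq]
  intro u hu v hv
  obtain ⟨x, hx, rfl⟩ := mem_eigenspace.mp hu
  obtain ⟨y, hy, rfl⟩ := mem_eigenspace.mp hv
  have h := inner_apply_eq_of_isSelfAdjoint hA x y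
  rw [hx, hy, inner_smul_left, inner_smul_right, RCLike.conj_ofReal] at h
  have h2 : ((l - m : ℝ) : 𝕜) * inner 𝕜 (x : H) (y : H) = 0 := by
    rw [RCLike.ofReal_sub, sub_mul, h, sub_self]
  refine (mul_eq_zero.mp h2).resolve_left ?_
  exact RCLike.ofReal_eq_zero.not.mpr (sub_ne_zero.mpr hlm)

/-- A bijective self-adjoint operator has a bounded symmetric inverse. -/
theorem exists_bounded_inverse {A : H →ₗ.[𝕜] H} (hA : IsSelfAdjoint A)
    (hbij : Function.Bijective A) :
    ∃ R : H →L[𝕜] H, (R : H →ₗ[𝕜] H).IsSymmetric ∧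
      (∀ x, ∃ y : A.domain, (y : H) = R x ∧ A y = x) ∧ ∀ y : A.domain, R (A y) = y := by
  let e : A.domain ≃ₗ[𝕜] H := LinearEquiv.ofBijective A.toFun hbij
  let R₀ : H →ₗ[𝕜] H := A.domain.subtype ∘ₗ e.symm.toLinearMap
  have h1 : ∀ x, A (e.symm x) = x := fun x => e.apply_symm_apply x
  have h2 : ∀ y, e.symm (A y) = y := fun y => e.symm_apply_apply y
  have hs : R₀.IsSymmetric := by
    intro x y
    have := inner_apply_eq_of_isSelfAdjoint hA (e.symm x) (e.symm y)
    rw [h1, h1] at this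
    exact this.symm
  -- Hellinger-Toeplitz: an everywhere defined symmetric operator is continuous.
  refine ⟨⟨R₀, hs.continuous⟩, hs, fun x => ⟨e.symm x, rfl, h1 x⟩, fun y => ?_⟩
  exact congrArg Subtype.val (h2 y)

/-- The eigenvectors of a positive self-adjoint operator with discrete spectrum are total. -/
theorem eq_zero_of_forall_inner_eigenspace {A : H →ₗ.[𝕜] H} (hA : IsSelfAdjoint A)
    (hpos : IsPositive A) (hdisc : HasDiscreteSpectrum A) {x : H}
    (hx : ∀ l : ℝ, ∀ ψ ∈ eigenspace A (l : 𝕜), inner 𝕜 ψ x = 0) : x = 0 := by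
  -- A spectral point `0` would be an eigenvalue by discreteness, which positivity forbids.
  have hbij : Function.Bijective A := by
    by_contra h
    have h0 : (0 : 𝕜) ∈ spectrum A := by
      simpa only [spectrum, mem_ofPred_eq, zero_smul, sub_zero] using h
    refine (hdisc 0 h0).2.1 ?_
    simpa using eigenspace_eq_bot_of_nonpos hpos le_rfl
  obtain ⟨R, hRs, hR1, hR2⟩ := exists_bounded_inverse hA hbij
  have hRs' : ∀ x y, inner 𝕜 (R x) y = inner 𝕜 x (R y) := hRs
  have hRpos : ∀ x, x ≠ 0 → 0 < RCLike.re (inner 𝕜 (R x) x) := by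
    intro x hx0
    obtain ⟨y, hy, rfl⟩ := hR1 x
    rw [hRs', hR2]
    refine hpos y fun h => hx0 ?_
    rw [ZeroMemClass.coe_eq_zero.mp h, LinearPMap.map_zero]
  have hReig : ∀ μ : ℝ, 0 < μ → ∀ x, R x = (μ : 𝕜) • x → x ∈ eigenspace A ((μ⁻¹ : ℝ) : 𝕜) := by
    intro μ hμ x hx
    have hμ' : (μ : 𝕜) ≠ 0 := by rw [Ne, RCLike.ofReal_eq_zero]; exact hμ.ne'
    obtain ⟨y, hy, hAy⟩ := hR1 x
    refine mem_eigenspace.mpr ⟨(μ : 𝕜)⁻¹ • y, ?_, ?_⟩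
    · rw [LinearPMap.map_smul, hAy, Submodule.coe_smul, hy, hx, RCLike.ofReal_inv, inv_smul_smul₀ hμ']
    · rw [Submodule.coe_smul, hy, hx, inv_smul_smul₀ hμ']
  have hRgap : ∀ s : ℝ, s ≠ 0 → ((s⁻¹ : ℝ) : 𝕜) ∉ spectrum A →
      ∃ κ > 0, ∀ x, κ * ‖x‖ ≤ ‖R x - (s : 𝕜) • x‖ := by
    intro s hs hsp
    have hs' : (s : 𝕜) ≠ 0 := by rwa [Ne, RCLike.ofReal_eq_zero]
    simp only [spectrum, mem_ofPred_eq, not_not] at hsp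
    have hb := bounded_below_of_bijective (R - (s : 𝕜) • ContinuousLinearMap.id 𝕜 H) (by
      -- The factorisation `(R - s) A = -s (A - s⁻¹)` transfers bijectivity from `A - s⁻¹` to `R -
      -- s`.
      have hval : ∀ y : A.domain, (R - (s : 𝕜) • ContinuousLinearMap.id 𝕜 H) (A y) =
          (-(s : 𝕜)) • (A y - ((s⁻¹ : ℝ) : 𝕜) • (y : H)) := by
        intro y
        change R (A y) - (s : 𝕜) • A y = _
        rw [hR2, smul_sub, smul_smul, RCLike.ofReal_inv, neg_mul, mul_inv_cancel₀ hs']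
        module
      have hcomp : Function.Bijective
          (fun y : A.domain => (R - (s : 𝕜) • ContinuousLinearMap.id 𝕜 H) (A y)) := by
        simp only [hval]
        exact (MulAction.bijective₀ (α := H) (neg_ne_zero.mpr hs')).comp hsp
      exact (Function.Bijective.of_comp_iff _ hbij).mp hcomp)
    exact hb
  let N : Submodule 𝕜 H := ⨅ l : ℝ, (eigenspace A (l : 𝕜))ᗮ
  have hN : ∀ {z : H}, z ∈ N ↔ ∀ l : ℝ, ∀ ψ ∈ eigenspace A (l : 𝕜), inner 𝕜 ψ z = 0 := by
    intro z
    simp only [N, Submodule.mem_iInf, Submodule.mem_orthogonal]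
  have hNc : IsClosed (N : Set H) := by
    rw [Submodule.coe_iInf]
    exact isClosed_iInter fun l => Submodule.isClosed_orthogonal _
  have : CompleteSpace N := hNc.completeSpace_coe
  have hRN : ∀ z ∈ N, R z ∈ N := by
    intro z hz
    rw [hN] at hz ⊢
    intro l ψ hψ
    rcases le_or_gt l 0 with hl | hl
    · rw [eigenspace_eq_bot_of_nonpos hpos hl, Submodule.mem_bot] at hψ
      rw [hψ, inner_zero_left]
    · obtain ⟨y, hy, rfl⟩ := mem_eigenspace.mp hψ
      have hl' : (l : 𝕜) ≠ 0 := by rw [Ne, RCLike.ofReal_eq_zero]; exact hl.ne'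
      have h := hR2 y
      rw [hy, map_smul] at h
      have h2 : R y = (l : 𝕜)⁻¹ • (y : H) := by
        rw [eq_inv_smul_iff₀ hl', h]
      rw [← hRs', h2, inner_smul_left, hz l _ hψ, mul_zero]
  let RN : N →L[𝕜] N := (R.comp N.subtypeL).codRestrict N fun z => hRN z z.2
  have hRNv : ∀ z : N, ((RN z : N) : H) = R z := fun z => rfl
  have key := eq_zero_of_isolated_of_no_eigenvector (R := RN) (fun a b => hRs' a b)
    (fun z hz => hRpos z fun h => hz (Subtype.ext h))
    (fun μ hμ z hz => by
      have h1 := hReig μ hμ z (congrArg Subtype.val hz)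
      exact Subtype.ext (inner_self_eq_zero.mp (hN.mp z.2 _ _ h1)))
    (fun μ hμ => by
      -- Discreteness speaks only of points in the spectrum. Off the spectrum, a lower bound `κ` for
      -- `R - μ` survives as `κ / 2` under perturbations smaller than `κ / 2`.
      by_cases hsp : ((μ⁻¹ : ℝ) : 𝕜) ∈ spectrum A
      swap
      · obtain ⟨κ, hκ, h⟩ := hRgap μ hμ.ne' hsp
        refine ⟨κ / 2, by positivity, fun s _ hsε => ⟨κ / 2, by positivity, fun z => ?_⟩⟩
        have e : R z - (μ : 𝕜) • (z : H) =
            (R z - (s : 𝕜) • (z : H)) + ((s - μ : ℝ) : 𝕜) • (z : H) := by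
          rw [RCLike.ofReal_sub]; module
        have h1 := h z
        rw [e] at h1
        have h2 := norm_add_le (R z - (s : 𝕜) • (z : H)) (((s - μ : ℝ) : 𝕜) • (z : H))
        rw [norm_smul, RCLike.norm_ofReal] at h2
        have h3 : κ / 2 * ‖(z : H)‖ ≤ ‖R z - (s : 𝕜) • (z : H)‖ := by
          nlinarith [norm_nonneg (z : H)]
        exact h3
      have hiso := (hdisc _ hsp).1
      have ht : Tendsto (fun s : ℝ => ((s⁻¹ : ℝ) : 𝕜)) (𝓝[≠] μ) (𝓝[≠] ((μ⁻¹ : ℝ) : 𝕜)) := by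
        refine tendsto_nhdsWithin_iff.mpr ⟨?_, ?_⟩
        · exact ((RCLike.continuous_ofReal.tendsto _).comp (tendsto_inv₀ hμ.ne')).mono_left
            nhdsWithin_le_nhds
        · filter_upwards [self_mem_nhdsWithin] with s hs
          simpa using hs
      have h1 : ∀ᶠ s in 𝓝[≠] μ, s ≠ 0 ∧ ((s⁻¹ : ℝ) : 𝕜) ∉ spectrum A :=
        ((eventually_ne_nhds hμ.ne').filter_mono nhdsWithin_le_nhds).and (ht.eventually hiso)
      rw [eventually_nhdsWithin_iff, Metric.eventually_nhds_iff] at h1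
      obtain ⟨ε, hε, h1⟩ := h1
      refine ⟨ε, hε, fun s hs hsε => ?_⟩
      obtain ⟨h2, h3⟩ := h1 (by rwa [Real.dist_eq]) hs
      obtain ⟨κ, hκ, h4⟩ := hRgap s h2 h3
      exact ⟨κ, hκ, fun z => h4 z⟩)
    ⟨x, hN.mpr hx⟩
  exact congrArg Subtype.val key

end Resolution

/-! ### Spectral projections, spectral calculus and convergence on eigenspaces. -/

section Calculus

variable {𝕜 : Type*} [RCLike 𝕜] {H : Type*} [NormedAddCommGroup H] [InnerProductSpace 𝕜 H]
  [CompleteSpace H]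

theorem spectralProj_mem (A : H →ₗ.[𝕜] H) (l : ℝ) (φ : H) :
    spectralProj A l φ ∈ (eigenspace A (l : 𝕜)).topologicalClosure :=
  Submodule.starProjection_apply_mem _ φ

theorem inner_spectralProj_self {A : H →ₗ.[𝕜] H} {l : ℝ} {ψ : H}
    (hψ : ψ ∈ eigenspace A (l : 𝕜)) (φ : H) :
    inner 𝕜 ψ (spectralProj A l φ) = inner 𝕜 ψ φ := by
  rw [spectralProj, ← Submodule.inner_starProjection_left_eq_right,
    Submodule.starProjection_eq_self_iff.mpr (Submodule.le_topologicalClosure _ hψ)]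

theorem orthogonalFamily_closure_eigenspace {A : H →ₗ.[𝕜] H} (hA : IsSelfAdjoint A) :
    OrthogonalFamily 𝕜 (fun l : ℝ => (eigenspace A (l : 𝕜)).topologicalClosure)
      (fun l => (eigenspace A (l : 𝕜)).topologicalClosure.subtypeₗᵢ) := by
  refine OrthogonalFamily.of_pairwise fun l m hlm => ?_
  have h := isOrtho_eigenspace hA hlm
  change _ ⟂ _
  rw [Submodule.isOrtho_iff_le] at h ⊢
  rw [Submodule.orthogonal_closure]
  exact Submodule.topologicalClosure_minimal _ h (Submodule.isClosed_orthogonal _)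

theorem inner_spectralProj_of_ne {A : H →ₗ.[𝕜] H} (hA : IsSelfAdjoint A) {l m : ℝ} (hlm : l ≠ m)
    {ψ : H} (hψ : ψ ∈ eigenspace A (l : 𝕜)) (φ : H) :
    inner 𝕜 ψ (spectralProj A m φ) = 0 :=
  orthogonalFamily_closure_eigenspace hA hlm ⟨ψ, Submodule.le_topologicalClosure _ hψ⟩
    ⟨_, spectralProj_mem A m φ⟩

/-- A subspace and its closure have the same orthogonal complement, so testing against genuine
eigenvectors determines the projection. -/
theorem spectralProj_eq_smul {A : H →ₗ.[𝕜] H} {l : ℝ} {c : 𝕜} {x y : H}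
    (h : ∀ ψ ∈ eigenspace A (l : 𝕜), inner 𝕜 ψ x = c * inner 𝕜 ψ y) :
    spectralProj A l x = c • spectralProj A l y := by
  rw [← map_smul, ← sub_eq_zero, ← map_sub, spectralProj,
    Submodule.starProjection_apply_eq_zero_iff, Submodule.orthogonal_closure,
    Submodule.mem_orthogonal]
  intro ψ hψ
  rw [inner_sub_right, inner_smul_right, h ψ hψ, sub_self]

theorem spectralProj_of_mem {A : H →ₗ.[𝕜] H} (hA : IsSelfAdjoint A) {l m : ℝ} (hlm : m ≠ l)
    {ψ : H} (hψ : ψ ∈ eigenspace A (l : 𝕜)) : spectralProj A m ψ = 0 := by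
  have := spectralProj_eq_smul (A := A) (l := m) (c := 0) (x := ψ) (y := ψ) fun χ hχ => by
    rw [zero_mul]
    exact (isOrtho_eigenspace hA hlm).inner_eq hχ hψ
  rw [this, zero_smul]

/-- Bessel's inequality for the spectral projections. -/
theorem summable_norm_sq_spectralProj {A : H →ₗ.[𝕜] H} (hA : IsSelfAdjoint A) (φ : H) :
    Summable fun l : ℝ => ‖spectralProj A l φ‖ ^ 2 := by
  refine summable_of_sum_le (c := ‖φ‖ ^ 2) (fun l => by positivity) fun s => ?_
  set y := ∑ l ∈ s, spectralProj A l φ with hy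
  have h1 : ‖y‖ ^ 2 = ∑ l ∈ s, ‖spectralProj A l φ‖ ^ 2 :=
    (orthogonalFamily_closure_eigenspace hA).norm_sum
      (fun l => ⟨spectralProj A l φ, spectralProj_mem A l φ⟩) s
  have h2 : RCLike.re (inner 𝕜 y φ) = ∑ l ∈ s, ‖spectralProj A l φ‖ ^ 2 := by
    rw [hy, sum_inner, map_sum]
    exact Finset.sum_congr rfl fun l _ => Submodule.re_inner_starProjection_eq_normSq _ φ
  rw [← h1]
  have h3 := re_inner_le_norm (𝕜 := 𝕜) y φ
  rw [h2, ← h1] at h3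
  have h4 : ‖y‖ ≤ ‖φ‖ := by
    by_contra! h
    nlinarith [norm_nonneg φ]
  exact pow_le_pow_left₀ (norm_nonneg _) h4 2

theorem hasSum_spectralMap {A : H →ₗ.[𝕜] H} (hA : IsSelfAdjoint A) {F : ℝ → ℝ} {φ : H}
    (hF : Summable fun l : ℝ => F l ^ 2 * ‖spectralProj A l φ‖ ^ 2) :
    HasSum (fun l : ℝ => ((F l : ℝ) : 𝕜) • spectralProj A l φ) (spectralMap A F φ) := by
  have h := ((orthogonalFamily_closure_eigenspace hA).summable_iff_norm_sq_summable
    (fun l => (F l : 𝕜) • ⟨spectralProj A l φ, spectralProj_mem A l φ⟩)).mpr (by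
      refine hF.congr fun l => ?_
      rw [norm_smul, RCLike.norm_ofReal, mul_pow, sq_abs]
      rfl)
  exact Summable.hasSum h

/-- Orthogonality leaves only the term at `l`. Summability is needed because the defining `tsum` is
otherwise a default value. -/
theorem inner_spectralMap {A : H →ₗ.[𝕜] H} (hA : IsSelfAdjoint A) {F : ℝ → ℝ} {φ : H}
    (hF : Summable fun l : ℝ => F l ^ 2 * ‖spectralProj A l φ‖ ^ 2) {l : ℝ} {ψ : H}
    (hψ : ψ ∈ eigenspace A (l : 𝕜)) :
    inner 𝕜 ψ (spectralMap A F φ) = F l * inner 𝕜 ψ φ := by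
  have h1 := (hasSum_spectralMap hA hF).mapL (innerSL 𝕜 ψ)
  simp only [innerSL_apply_apply, inner_smul_right] at h1
  have h2 := hasSum_single (f := fun m : ℝ => ((F m : ℝ) : 𝕜) * inner 𝕜 ψ (spectralProj A m φ)) l
    fun m hm => by rw [inner_spectralProj_of_ne hA hm.symm hψ, mul_zero]
  rw [h1.unique h2, inner_spectralProj_self hψ]

theorem inner_spectralMap_of_bounded {A : H →ₗ.[𝕜] H} (hA : IsSelfAdjoint A) {F : ℝ → ℝ}
    (hF : ∀ l, F l ^ 2 ≤ 1) (φ : H) {l : ℝ} {ψ : H} (hψ : ψ ∈ eigenspace A (l : 𝕜)) :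
    inner 𝕜 ψ (spectralMap A F φ) = F l * inner 𝕜 ψ φ :=
  inner_spectralMap hA ((summable_norm_sq_spectralProj hA φ).of_nonneg_of_le
    (fun l => by positivity) fun l => mul_le_of_le_one_left (by positivity) (hF l)) hψ

theorem inner_cosA {A : H →ₗ.[𝕜] H} (hA : IsSelfAdjoint A) (T : ℝ) (φ : H) {l : ℝ} {ψ : H}
    (hψ : ψ ∈ eigenspace A (l : 𝕜)) :
    inner 𝕜 ψ (cosA A T φ) = (Real.cos (l * T) : ℝ) * inner 𝕜 ψ φ :=
  inner_spectralMap_of_bounded hA (fun _ => Real.cos_sq_le_one _) φ hψ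

theorem inner_sinA {A : H →ₗ.[𝕜] H} (hA : IsSelfAdjoint A) (T : ℝ) (φ : H) {l : ℝ} {ψ : H}
    (hψ : ψ ∈ eigenspace A (l : 𝕜)) :
    inner 𝕜 ψ (sinA A T φ) = (Real.sin (l * T) : ℝ) * inner 𝕜 ψ φ :=
  inner_spectralMap_of_bounded hA (fun _ => Real.sin_sq_le_one _) φ hψ

theorem summable_of_mem_sobolev {A : H →ₗ.[𝕜] H} {φ : H} (hφ : φ ∈ sobolev A 1) :
    Summable fun l : ℝ => l ^ 2 * ‖spectralProj A l φ‖ ^ 2 := by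
  have h1 : ∑' l : ℝ, ENNReal.ofReal ((1 + l ^ 2) ^ (1 : ℝ) * ‖spectralProj A l φ‖ ^ 2) ≠ ∞ := by
    intro h
    change sobolevNorm A 1 φ < ∞ at hφ
    rw [sobolevNorm, h, ENNReal.top_rpow_of_pos (by norm_num)] at hφ
    exact lt_irrefl _ hφ
  have h2 := ENNReal.summable_toReal h1
  refine h2.of_nonneg_of_le (fun l => by positivity) fun l => ?_
  rw [ENNReal.toReal_ofReal (by positivity), Real.rpow_one]
  exact mul_le_mul_of_nonneg_right (by linarith) (by positivity)

theorem inner_opA {A : H →ₗ.[𝕜] H} (hA : IsSelfAdjoint A) {φ : H} (hφ : φ ∈ sobolev A 1)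
    {l : ℝ} {ψ : H} (hψ : ψ ∈ eigenspace A (l : 𝕜)) :
    inner 𝕜 ψ (opA A φ) = (l : 𝕜) * inner 𝕜 ψ φ :=
  inner_spectralMap hA (summable_of_mem_sobolev hφ) hψ

theorem mem_sobolev_of_mem_eigenspace {A : H →ₗ.[𝕜] H} (hA : IsSelfAdjoint A) {l : ℝ} {ψ : H}
    (hψ : ψ ∈ eigenspace A (l : 𝕜)) (s : ℝ) : ψ ∈ sobolev A s := by
  change sobolevNorm A s ψ < ∞
  rw [sobolevNorm, tsum_eq_single l fun m hm => by
    rw [spectralProj_of_mem hA hm hψ]; simp]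
  exact ENNReal.rpow_lt_top_of_nonneg (by norm_num) ENNReal.ofReal_ne_top

theorem opA_of_mem_eigenspace {A : H →ₗ.[𝕜] H} (hA : IsSelfAdjoint A) {l : ℝ} {ψ : H}
    (hψ : ψ ∈ eigenspace A (l : 𝕜)) : opA A ψ = (l : 𝕜) • ψ := by
  rw [opA, spectralMap, tsum_eq_single l fun m hm => by
    rw [spectralProj_of_mem hA hm hψ, smul_zero]]
  rw [spectralProj,
    Submodule.starProjection_eq_self_iff.mpr (Submodule.le_topologicalClosure _ hψ)]

theorem ext_inner_eigenspace {A : H →ₗ.[𝕜] H} (hA : IsSelfAdjoint A)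
    (hpos : IsPositive A) (hdisc : HasDiscreteSpectrum A) {x y : H}
    (h : ∀ l : ℝ, ∀ ψ ∈ eigenspace A (l : 𝕜), inner 𝕜 ψ x = inner 𝕜 ψ y) : x = y := by
  rw [← sub_eq_zero]
  refine eq_zero_of_forall_inner_eigenspace hA hpos hdisc fun l ψ hψ => ?_
  rw [inner_sub_right, h l ψ hψ, sub_self]

/-- Parseval's identity for the spectral projections. -/
theorem hasSum_norm_sq_spectralProj {A : H →ₗ.[𝕜] H} (hA : IsSelfAdjoint A)
    (hpos : IsPositive A) (hdisc : HasDiscreteSpectrum A) (φ : H) :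
    HasSum (fun l : ℝ => ‖spectralProj A l φ‖ ^ 2) (‖φ‖ ^ 2) := by
  have hs : Summable fun l : ℝ => (1 : ℝ) ^ 2 * ‖spectralProj A l φ‖ ^ 2 := by
    simpa using summable_norm_sq_spectralProj hA φ
  have h1 := hasSum_spectralMap hA (F := fun _ => 1) hs
  -- Totality enters here and upgrades Bessel's inequality to an equality.
  have h2 : spectralMap A (fun _ => 1) φ = φ :=
    ext_inner_eigenspace hA hpos hdisc fun l ψ hψ => by
      rw [inner_spectralMap hA hs hψ]; simp
  rw [h2] at h1
  have h3 := (h1.mapL (innerSL 𝕜 φ)).mapL (RCLike.reCLM (K := 𝕜))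
  simp only [innerSL_apply_apply, RCLike.ofReal_one, one_smul, RCLike.reCLM_apply,
    inner_self_eq_norm_sq] at h3
  refine h3.congr_fun fun l => ?_
  rw [spectralProj, ← Submodule.inner_starProjection_left_eq_right]
  exact (Submodule.re_inner_starProjection_eq_normSq _ φ).symm

theorem inner_iterMap {A : H →ₗ.[𝕜] H} (hA : IsSelfAdjoint A) (T : ℝ) {f g : H}
    (hf : f ∈ sobolev A 1) (hg : g ∈ sobolev A 1) (φ : H) {l : ℝ} {ψ : H}
    (hψ : ψ ∈ eigenspace A (l : 𝕜)) :
    inner 𝕜 ψ (iterMap A T f g φ) =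
      (Real.cos (l * T) : ℝ) * ((Real.cos (l * T) : ℝ) * inner 𝕜 ψ φ) +
      (-((Real.cos (l * T) : ℝ) * ((Real.sin (l * T) : ℝ) * (l * inner 𝕜 ψ f))) +
        (Real.sin (l * T) : ℝ) * (l * inner 𝕜 ψ g)) := by
  simp only [iterMap, inner_add_right, inner_neg_right, inner_cosA hA _ _ hψ,
    inner_sinA hA _ _ hψ, inner_opA hA hf hψ, inner_opA hA hg hψ]

/-- A sequence whose error is multiplied by a factor `q l ∈ [0, 1)` in every step on each nonzero
eigenspace `ker (A - l)` converges. -/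
theorem tendsto_of_inner_eq_pow {A : H →ₗ.[𝕜] H} (hA : IsSelfAdjoint A)
    (hpos : IsPositive A) (hdisc : HasDiscreteSpectrum A) {q : ℝ → ℝ} (hq0 : ∀ l, 0 ≤ q l)
    (hq1 : ∀ l, q l ≤ 1) (hq : ∀ l : ℝ, eigenspace A (l : 𝕜) ≠ ⊥ → q l < 1) {x : ℕ → H} {y : H}
    (hx : ∀ (k : ℕ) (l : ℝ), ∀ ψ ∈ eigenspace A (l : 𝕜),
      inner 𝕜 ψ (x k - y) = ((q l ^ k : ℝ) : 𝕜) * inner 𝕜 ψ (x 0 - y)) :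
    Tendsto x atTop (𝓝 y) := by
  have hP : ∀ k l, ‖spectralProj A l (x k - y)‖ ^ 2 =
      (q l ^ k) ^ 2 * ‖spectralProj A l (x 0 - y)‖ ^ 2 := by
    intro k l
    rw [spectralProj_eq_smul (hx k l), norm_smul, RCLike.norm_ofReal, mul_pow, sq_abs]
  have hn : ∀ k, ‖x k - y‖ ^ 2 = ∑' l, (q l ^ k) ^ 2 * ‖spectralProj A l (x 0 - y)‖ ^ 2 := by
    intro k
    rw [← (hasSum_norm_sq_spectralProj hA hpos hdisc (x k - y)).tsum_eq]
    exact tsum_congr (hP k)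
  have hlim : Tendsto (fun k => ‖x k - y‖ ^ 2) atTop (𝓝 0) := by
    have h := tendsto_tsum_of_dominated_convergence (𝓕 := atTop)
      (f := fun (k : ℕ) l => (q l ^ k) ^ 2 * ‖spectralProj A l (x 0 - y)‖ ^ 2)
      (g := fun _ => (0 : ℝ)) (summable_norm_sq_spectralProj hA (x 0 - y)) (fun l => by
        -- The index runs over all reals, and `q l` may equal `1` off the eigenvalues; there the
        -- projection vanishes.
        by_cases hl : eigenspace A (l : 𝕜) = ⊥
        · have h0 : spectralProj A l (x 0 - y) = 0 := by
            have := spectralProj_eq_smul (A := A) (l := l) (c := 0) (x := x 0 - y) (y := x 0 - y)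
              fun ψ hψ => by
                rw [hl, Submodule.mem_bot] at hψ
                rw [hψ, inner_zero_left, mul_zero]
            rw [this, zero_smul]
          simp [h0]
        · have := ((tendsto_pow_atTop_nhds_zero_of_lt_one (hq0 l) (hq l hl)).pow 2).mul_const
            (‖spectralProj A l (x 0 - y)‖ ^ 2)
          simpa using this) (Eventually.of_forall fun k l => by
        have h1 : q l ^ k ≤ 1 := pow_le_one₀ (hq0 l) (hq1 l)
        have h2 : 0 ≤ q l ^ k := pow_nonneg (hq0 l) k
        rw [Real.norm_of_nonneg (by positivity)]
        exact mul_le_of_le_one_left (by positivity) (pow_le_one₀ h2 h1))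
    simp only [tsum_zero] at h
    exact h.congr fun k => (hn k).symm
  rw [tendsto_iff_norm_sub_tendsto_zero]
  have := hlim.sqrt
  simpa using this

end Calculus

/-! ### Oscillators on eigenspaces and the iteration. -/

section WaveEquation

/-- The weak equation holds only on the open interval; continuity carries constancy to the end
points. -/
theorem eq_endpoints_of_hasDerivAt_zero {E : Type*} [NormedAddCommGroup E] [NormedSpace ℝ E]
    {f : ℝ → E} {T : ℝ} (hT : 0 < T) (hc : ContinuousOn f (Icc 0 T))
    (hd : ∀ t ∈ Ioo 0 T, HasDerivAt f 0 t) : f T = f 0 := by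
  have h1 : ∀ ε ∈ Ioo 0 T, f ε = f T := by
    intro ε hε
    have := constant_of_has_deriv_right_zero (hc.mono (Icc_subset_Icc_left hε.1.le))
      (fun x hx => (hd x ⟨hε.1.trans_le hx.1, hx.2⟩).hasDerivWithinAt) T ⟨hε.2.le, le_rfl⟩
    exact this.symm
  have h2 : Tendsto f (𝓝[Ioo 0 T] 0) (𝓝 (f 0)) :=
    (hc 0 ⟨le_rfl, hT.le⟩).mono_left (nhdsWithin_mono _ Ioo_subset_Icc_self)
  have h3 : Tendsto f (𝓝[Ioo 0 T] 0) (𝓝 (f T)) :=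
    tendsto_const_nhds.congr' (by
      filter_upwards [self_mem_nhdsWithin] with ε hε using (h1 ε hε).symm)
  have : (𝓝[Ioo 0 T] (0 : ℝ)).NeBot := by
    rw [← mem_closure_iff_nhdsWithin_neBot, closure_Ioo hT.ne]
    exact ⟨le_rfl, hT.le⟩
  exact tendsto_nhds_unique h3 h2

variable {𝕜 : Type*} [RCLike 𝕜]

/-- The end-point values of a solution of the scalar oscillator equation with frequency `l`. -/
theorem oscillator_endpoints {a b : ℝ → 𝕜} {l T : ℝ} (hT : 0 < T)
    (hac : ContinuousOn a (Icc 0 T)) (hbc : ContinuousOn b (Icc 0 T))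
    (ha : ∀ t ∈ Ioo 0 T, HasDerivAt a (b t) t)
    (hb : ∀ t ∈ Ioo 0 T, HasDerivAt b (-((l : 𝕜) ^ 2 * a t)) t) :
    (l : 𝕜) * a T = l * (Real.cos (l * T) : ℝ) * a 0 + (Real.sin (l * T) : ℝ) * b 0 ∧
      b T = -(l * (Real.sin (l * T) : ℝ) * a 0) + (Real.cos (l * T) : ℝ) * b 0 := by
  have hcos : ∀ t, HasDerivAt (fun t => ((Real.cos (l * t) : ℝ) : 𝕜))
      (-(l * (Real.sin (l * t) : ℝ))) t := by
    intro t
    have h : HasDerivAt (fun t => Real.cos (l * t)) (-Real.sin (l * t) * (l * 1)) t :=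
      ((hasDerivAt_id t).const_mul l).cos
    refine ((RCLike.ofRealCLM (K := 𝕜)).hasFDerivAt.comp_hasDerivAt t h).congr_deriv ?_
    rw [RCLike.ofRealCLM_apply]
    push_cast; ring
  have hsin : ∀ t, HasDerivAt (fun t => ((Real.sin (l * t) : ℝ) : 𝕜))
      (l * (Real.cos (l * t) : ℝ)) t := by
    intro t
    have h : HasDerivAt (fun t => Real.sin (l * t)) (Real.cos (l * t) * (l * 1)) t :=
      ((hasDerivAt_id t).const_mul l).sin
    refine ((RCLike.ofRealCLM (K := 𝕜)).hasFDerivAt.comp_hasDerivAt t h).congr_deriv ?_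
    rw [RCLike.ofRealCLM_apply]
    push_cast; ring
  have hcosc : Continuous fun t => ((Real.cos (l * t) : ℝ) : 𝕜) :=
    RCLike.continuous_ofReal.comp (by fun_prop)
  have hsinc : Continuous fun t => ((Real.sin (l * t) : ℝ) : 𝕜) :=
    RCLike.continuous_ofReal.comp (by fun_prop)
  -- `e1` and `e2` are the two conserved components of `(l * a, b)` rotated back by the angle `l *
  -- t`. Keeping the factor `l` on `a` avoids dividing by it.
  have e1 := eq_endpoints_of_hasDerivAt_zero
    (f := fun t => (l : 𝕜) * a t * (Real.cos (l * t) : ℝ) - b t * (Real.sin (l * t) : ℝ)) hT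
    (((continuousOn_const.mul hac).mul hcosc.continuousOn).sub (hbc.mul hsinc.continuousOn))
    (fun t ht => by
      refine ((((ha t ht).const_mul (l : 𝕜)).mul (hcos t)).sub ((hb t ht).mul (hsin t))).congr_deriv ?_
      ring)
  have e2 := eq_endpoints_of_hasDerivAt_zero
    (f := fun t => (l : 𝕜) * a t * (Real.sin (l * t) : ℝ) + b t * (Real.cos (l * t) : ℝ)) hT
    (((continuousOn_const.mul hac).mul hsinc.continuousOn).add (hbc.mul hcosc.continuousOn))
    (fun t ht => by
      refine ((((ha t ht).const_mul (l : 𝕜)).mul (hsin t)).add ((hb t ht).mul (hcos t))).congr_deriv ?_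
      ring)
  simp only [mul_zero, Real.cos_zero, Real.sin_zero, RCLike.ofReal_one, RCLike.ofReal_zero,
    mul_one, sub_zero, zero_add] at e1 e2
  have hcs : ((Real.cos (l * T) : ℝ) : 𝕜) ^ 2 + ((Real.sin (l * T) : ℝ) : 𝕜) ^ 2 = 1 := by
    exact_mod_cast congrArg (fun r : ℝ => (r : 𝕜)) (Real.cos_sq_add_sin_sq (l * T))
  constructor
  · linear_combination ((Real.cos (l * T) : ℝ) : 𝕜) * e1 + ((Real.sin (l * T) : ℝ) : 𝕜) * e2 -
      (l : 𝕜) * a T * hcs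
  · linear_combination -((Real.sin (l * T) : ℝ) : 𝕜) * e1 + ((Real.cos (l * T) : ℝ) : 𝕜) * e2 -
      b T * hcs

variable {H : Type*} [NormedAddCommGroup H] [InnerProductSpace 𝕜 H]

theorem cos_sq_lt_one_of_eigenspace_ne_bot {A : H →ₗ.[𝕜] H} (hpos : IsPositive A) {T : ℝ}
    (hT : 0 < T)
    (hres : ∀ k : ℕ, 1 ≤ k → eigenspace A ((k * Real.pi / T : ℝ) : 𝕜) = ⊥) {l : ℝ}
    (hl : eigenspace A (l : 𝕜) ≠ ⊥) : Real.cos (l * T) ^ 2 < 1 := by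
  have hl0 : 0 < l := by
    by_contra! h
    exact hl (eigenspace_eq_bot_of_nonpos hpos h)
  refine lt_of_le_of_ne (Real.cos_sq_le_one _) fun h => ?_
  have hs : Real.sin (l * T) = 0 := by
    have := Real.sin_sq_add_cos_sq (l * T)
    exact pow_eq_zero_iff two_ne_zero |>.mp (by linarith)
  obtain ⟨n, hn⟩ := Real.sin_eq_zero_iff.mp hs
  have hn0 : 0 < n := by
    have h1 : 0 < (n : ℝ) * Real.pi := by rw [hn]; positivity
    exact_mod_cast pos_of_mul_pos_left h1 Real.pi_pos.le
  lift n to ℕ using hn0.le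
  refine hl ?_
  rw [← hres n (by exact_mod_cast hn0)]
  congr 2
  rw [eq_div_iff hT.ne', ← hn]
  push_cast
  rfl

variable [NormedSpace ℝ H] [CompleteSpace H]

/-- An eigenvector lies in `sobolev A 1`, so it is an admissible test vector and reduces the wave
equation to a scalar oscillator. -/
theorem MemVh.inner_endpoints {A : H →ₗ.[𝕜] H} (hA : IsSelfAdjoint A) {T : ℝ} (hT : 0 < T)
    {v : ℝ → H} (hv : MemVh A T v) {l : ℝ} {ψ : H} (hψ : ψ ∈ eigenspace A (l : 𝕜)) :
    (l : 𝕜) * inner 𝕜 ψ (v T) = l * (Real.cos (l * T) : ℝ) * inner 𝕜 ψ (v 0) +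
        (Real.sin (l * T) : ℝ) * inner 𝕜 ψ (timeDeriv T v 0) ∧
      inner 𝕜 ψ (timeDeriv T v T) = -(l * (Real.sin (l * T) : ℝ) * inner 𝕜 ψ (v 0)) +
        (Real.cos (l * T) : ℝ) * inner 𝕜 ψ (timeDeriv T v 0) := by
  -- No compatibility between the real and the `𝕜`-structure on `H` is assumed; a continuous
  -- additive map is real linear anyway.
  let L : H →L[ℝ] 𝕜 := AddMonoidHom.toRealLinearMap ((innerSL 𝕜 ψ : H →L[𝕜] 𝕜) : H →+ 𝕜)
    (innerSL 𝕜 ψ).continuous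
  have hL : ∀ x, L x = inner 𝕜 ψ x := fun x => rfl
  refine oscillator_endpoints (a := fun t => inner 𝕜 ψ (v t))
    (b := fun t => inner 𝕜 ψ (timeDeriv T v t)) hT
    (L.continuous.comp_continuousOn hv.diff.continuousOn)
    (L.continuous.comp_continuousOn hv.cont_deriv) (fun t ht => ?_) (fun t ht => ?_)
  · have h1 : HasDerivAt v (timeDeriv T v t) t :=
      ((hv.diff t (Ioo_subset_Icc_self ht)).hasDerivWithinAt).hasDerivAt (Icc_mem_nhds ht.1 ht.2)
    exact L.hasFDerivAt.comp_hasDerivAt t h1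
  · have h1 := hv.wave ψ (mem_sobolev_of_mem_eigenspace hA hψ 1) t ht
    rw [opA_of_mem_eigenspace hA hψ, inner_smul_left, RCLike.conj_ofReal,
      inner_opA hA (hv.mem t (Ioo_subset_Icc_self ht)) hψ, ← mul_assoc, ← sq] at h1
    exact h1

theorem iterMap_eq_of_isIterStep {A : H →ₗ.[𝕜] H} (hA : IsSelfAdjoint A)
    (hpos : IsPositive A) (hdisc : HasDiscreteSpectrum A) {T : ℝ} (hT : 0 < T) {f g φ φ' : H}
    (hf : f ∈ sobolev A 1) (hg : g ∈ sobolev A 1) (h : IsIterStep A T f g φ φ') :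
    φ' = iterMap A T f g φ := by
  obtain ⟨v, w, hv, hw, hv0, hv1, hwT, hw1, hw0⟩ := h
  refine ext_inner_eigenspace hA hpos hdisc fun l ψ hψ => ?_
  obtain ⟨-, h2⟩ := hv.inner_endpoints hA hT hψ
  obtain ⟨h3, h4⟩ := hw.inner_endpoints hA hT hψ
  rw [inner_iterMap hA T hf hg φ hψ]
  rw [hv0, hv1] at h2
  rw [hwT, hw0] at h3
  rw [hw1, hw0, h2] at h4
  have hcs : ((Real.cos (l * T) : ℝ) : 𝕜) ^ 2 + ((Real.sin (l * T) : ℝ) : 𝕜) ^ 2 = 1 := by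
    exact_mod_cast congrArg (fun r : ℝ => (r : 𝕜)) (Real.cos_sq_add_sin_sq (l * T))
  -- This combination inverts the rotation and eliminates the unknown `w 0`.
  linear_combination -((Real.sin (l * T) : ℝ) : 𝕜) * h3 - ((Real.cos (l * T) : ℝ) : 𝕜) * h4 -
    inner 𝕜 ψ φ' * hcs

/-- Convergence of the iterative procedure in an abstract Hilbert space. -/
theorem tendsto_iterate_iterMap {A : H →ₗ.[𝕜] H} (hA : IsSelfAdjoint A)
    (hpos : IsPositive A) (hdisc : HasDiscreteSpectrum A) {T : ℝ} (hT : 0 < T)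
    (hres : ∀ k : ℕ, 1 ≤ k → eigenspace A ((k * Real.pi / T : ℝ) : 𝕜) = ⊥) {f g : H}
    (hf : f ∈ sobolev A 1) (hg : g ∈ sobolev A 1) {u : ℝ → H}
    (hu : SolvesDirichlet A T f g u) (φ₀ : H) :
    Tendsto (fun k : ℕ => (iterMap A T f g)^[k] φ₀) atTop (𝓝 (timeDeriv T u 0)) := by
  refine tendsto_of_inner_eq_pow hA hpos hdisc (q := fun l => Real.cos (l * T) ^ 2)
    (fun l => sq_nonneg _) (fun l => Real.cos_sq_le_one _)
    (fun l hl => cos_sq_lt_one_of_eigenspace_ne_bot hpos hT hres hl) fun k l ψ hψ => ?_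
  induction k with
  | zero => simp
  | succ k ih =>
    rw [inner_sub_right] at ih ⊢
    obtain ⟨h, -⟩ := hu.memVh.inner_endpoints hA hT hψ
    rw [hu.initial, hu.final] at h
    rw [Function.iterate_succ_apply', inner_iterMap hA T hf hg _ hψ]
    have hcs : ((Real.cos (l * T) : ℝ) : 𝕜) ^ 2 + ((Real.sin (l * T) : ℝ) : 𝕜) ^ 2 = 1 := by
      exact_mod_cast congrArg (fun r : ℝ => (r : 𝕜)) (Real.cos_sq_add_sin_sq (l * T))
    rw [pow_succ]
    push_cast at ih hcs h ⊢
    -- Consistency `h` turns the inhomogeneous term into `sin² * u'(0)`, so `u'(0)` is a fixed point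
    -- on each eigenspace.
    linear_combination ((Real.cos (l * T) : ℝ) : 𝕜) ^ 2 * ih + ((Real.sin (l * T) : ℝ) : 𝕜) * h +
      inner 𝕜 ψ (timeDeriv T u 0) * hcs

end WaveEquation

end HyperbolicDirichlet

/-! ### The theorem on the space of square-integrable functions. -/

theorem mainTheorem2 {𝕜 : Type*} [RCLike 𝕜] {d : ℕ} (Ω : Set (EuclideanSpace ℝ (Fin d)))
    (_hΩ : IsOpen Ω) (_hΩb : Bornology.IsBounded Ω)
    (A : Lp 𝕜 2 (volume.restrict Ω) →ₗ.[𝕜] Lp 𝕜 2 (volume.restrict Ω))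
    (_hA : IsSelfAdjoint A) (_hpos : HyperbolicDirichlet.IsPositive A)
    (_hdisc : HyperbolicDirichlet.HasDiscreteSpectrum A)
    (T : ℝ) (_hT : 0 < T)
    (_hres : ∀ k : ℕ, 1 ≤ k →
      HyperbolicDirichlet.eigenspace A ((k * Real.pi / T : ℝ) : 𝕜) = ⊥)
    (f g : Lp 𝕜 2 (volume.restrict Ω))
    (_hf : f ∈ HyperbolicDirichlet.sobolev A 1) (_hg : g ∈ HyperbolicDirichlet.sobolev A 1)
    (u : ℝ → Lp 𝕜 2 (volume.restrict Ω))
    (_hu : HyperbolicDirichlet.SolvesDirichlet A T f g u) :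
    (∀ φ₀ : Lp 𝕜 2 (volume.restrict Ω),
      Tendsto (fun k : ℕ => (HyperbolicDirichlet.iterMap A T f g)^[k] φ₀) atTop
        (𝓝 (HyperbolicDirichlet.timeDeriv T u 0))) ∧
    (∀ φ : ℕ → Lp 𝕜 2 (volume.restrict Ω),
      (∀ k, HyperbolicDirichlet.IsIterStep A T f g (φ k) (φ (k + 1))) →
        (∀ k, φ k = (HyperbolicDirichlet.iterMap A T f g)^[k] (φ 0)) ∧
        Tendsto φ atTop (𝓝 (HyperbolicDirichlet.timeDeriv T u 0))) := by
  have hconv := HyperbolicDirichlet.tendsto_iterate_iterMap _hA _hpos _hdisc _hT _hres _hf _hg _hu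
  refine ⟨hconv, fun φ hφ => ?_⟩
  have hiter : ∀ k, φ k = (HyperbolicDirichlet.iterMap A T f g)^[k] (φ 0) := by
    intro k
    induction k with
    | zero => rfl
    | succ k ih =>
      rw [Function.iterate_succ_apply', ← ih]
      exact HyperbolicDirichlet.iterMap_eq_of_isIterStep _hA _hpos _hdisc _hT _hf _hg (hφ k)
  exact ⟨hiter, (hconv (φ 0)).congr fun k => (hiter k).symm⟩
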